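/- Let $\Omega\subset\mathbb{R}^2$ be a compact convex set with nonempty interior, and let $\mathcal{U}_\Omega$ be the class of continuous concave functions $u$ on $\Omega$ that vanish on $\partial\Omega$ and whose gradient $(u_x,u_y)$ is uniformly bounded over all points of $\operatorname{int}\Omega$ where it is defined. Put $$K_\infty(\Omega)=\sup_{u\in\mathcal{U}_\Omega,\ u\neq 0}\frac{\|u_x\|_\infty}{\|u_y\|_\infty}\in[0,\infty],\qquad \|f\|_\infty=\operatorname*{ess\,sup}_{\Omega}|f|.$$ Write $\Omega=\{(x,y): a\le x\le b,\ \varphi_1(x)\le y\le\varphi_2(x)\}$, with $\varphi_1$ convex and $\varphi_2$ concave on $[a,b]$, and let $m\in[0,\infty]$ be the maximum of $|\varphi_i'(x)|$ over $i\in\{1,2\}$ and $x\in[a,b]$, where $\varphi_i'$ stands for the one-sided derivatives, possibly infinite (the right derivative at points of $[a,b)$, the left derivative at points of $(a,b]$). The tangent cone to $\Omega$ at $\xi\in\partial\Omega$ is the intersection of all closed half-planes that contain $\Omega$ and are bounded by lines of support through $\xi$; the point $\xi$ is singular if there is more than one line of support through it. A line of support to $\Omega$ is called angular if, for some singular point $\xi\in\partial\Omega$,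 it meets the tangent cone at $\xi$ only in the vertex $\xi$. If both vertical lines of support of $\Omega$ (those parallel to the $y$-axis) are angular, then $K_\infty(\Omega)=m<\infty$. Otherwise $K_\infty(\Omega)=\infty$. -/

import Mathlib

open Set Filter Topology MeasureTheory
open scoped ENNReal

noncomputable section

/-- `ℓ` is a line of support to `Ω`: a straight line `α x + β y = c` that meets `Ω` and bounds a
closed half-plane containing `Ω`. -/
def IsSupportLine (Ω : Set (ℝ × ℝ)) (ℓ : Set (ℝ × ℝ)) : Prop :=
  ∃ α β c : ℝ, (α, β) ≠ (0, 0) ∧ ℓ = {p | α * p.1 + β * p.2 = c} ∧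
    (∀ p ∈ Ω, α * p.1 + β * p.2 ≤ c) ∧ (ℓ ∩ Ω).Nonempty

/-- The tangent cone to `Ω` with vertex `ξ`: the intersection of all closed half-planes that
contain `Ω` and are bounded by lines through `ξ` (lines of support, when `ξ ∈ Ω`). -/
def tangentConeWithVertex (Ω : Set (ℝ × ℝ)) (ξ : ℝ × ℝ) : Set (ℝ × ℝ) :=
  {q | ∀ α β : ℝ, (α, β) ≠ (0, 0) →
    (∀ p ∈ Ω, α * p.1 + β * p.2 ≤ α * ξ.1 + β * ξ.2) →
      α * q.1 + β * q.2 ≤ α * ξ.1 + β * ξ.2}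

/-- A boundary point is singular if it does not have exactly one line of support through it. -/
def IsSingularPoint (Ω : Set (ℝ × ℝ)) (ξ : ℝ × ℝ) : Prop :=
  ξ ∈ frontier Ω ∧ ¬ ∃! ℓ : Set (ℝ × ℝ), IsSupportLine Ω ℓ ∧ ξ ∈ ℓ

/-- A support line is angular if it meets the tangent cone at some singular boundary point
exactly in the vertex of that cone. -/
def IsAngularSupportLine (Ω : Set (ℝ × ℝ)) (ℓ : Set (ℝ × ℝ)) : Prop :=
  IsSupportLine Ω ℓ ∧ ∃ ξ, IsSingularPoint Ω ξ ∧ ℓ ∩ tangentConeWithVertex Ω ξ = {ξ}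

/-- The line `x = c`, parallel to the `y`-axis. -/
def verticalLine (c : ℝ) : Set (ℝ × ℝ) := {p | p.1 = c}

/-- All vertical lines of support to `Ω` are angular (a compact convex `Ω` with nonempty interior
has exactly two of them). -/
def VerticalSupportLinesAngular (Ω : Set (ℝ × ℝ)) : Prop :=
  ∀ c : ℝ, IsSupportLine Ω (verticalLine c) → IsAngularSupportLine Ω (verticalLine c)

/-- The left end `a` of the projection `[a, b]` of `Ω` to the `x`-axis. -/
def leftEnd (Ω : Set (ℝ × ℝ)) : ℝ := sInf (Prod.fst '' Ω)

/-- The right end `b` of the projection `[a, b]` of `Ω` to the `x`-axis. -/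
def rightEnd (Ω : Set (ℝ × ℝ)) : ℝ := sSup (Prod.fst '' Ω)

/-- The function `φ₁` whose graph bounds `Ω` from below. -/
def lowerBoundary (Ω : Set (ℝ × ℝ)) (x : ℝ) : ℝ := sInf {y | (x, y) ∈ Ω}

/-- The function `φ₂` whose graph bounds `Ω` from above. -/
def upperBoundary (Ω : Set (ℝ × ℝ)) (x : ℝ) : ℝ := sSup {y | (x, y) ∈ Ω}

/-- The set of all one-sided derivatives, possibly infinite, of `φ` on the segment `[a, b]`: right
derivatives at the points of `[a, b)` and left derivatives at the points of `(a, b]`. -/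
def oneSidedDerivatives (φ : ℝ → ℝ) (a b : ℝ) : Set EReal :=
  {d | (∃ x ∈ Ico a b, Tendsto (fun t => (((φ t - φ x) / (t - x) : ℝ) : EReal)) (𝓝[>] x) (𝓝 d)) ∨
       (∃ x ∈ Ioc a b, Tendsto (fun t => (((φ t - φ x) / (t - x) : ℝ) : EReal)) (𝓝[<] x) (𝓝 d))}

/-- The maximal absolute slope `m ∈ [0, ∞]` of the two boundary graphs over `[a, b]`. -/
def maxBoundarySlope (Ω : Set (ℝ × ℝ)) : ℝ≥0∞ :=
  sSup (EReal.abs ''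
    (oneSidedDerivatives (lowerBoundary Ω) (leftEnd Ω) (rightEnd Ω) ∪
      oneSidedDerivatives (upperBoundary Ω) (leftEnd Ω) (rightEnd Ω)))

/-- The partial derivative `u_x`. -/
def partialX (u : ℝ × ℝ → ℝ) (p : ℝ × ℝ) : ℝ := lineDeriv ℝ u p (1, 0)

/-- The partial derivative `u_y`. -/
def partialY (u : ℝ × ℝ → ℝ) (p : ℝ × ℝ) : ℝ := lineDeriv ℝ u p (0, 1)

/-- The class `𝒰_Ω`: continuous concave functions on `Ω` that vanish on the boundary and whose
gradient is uniformly bounded over all interior points where it is defined. Only the values of `u`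
on `Ω` are constrained. -/
structure MemU (Ω : Set (ℝ × ℝ)) (u : ℝ × ℝ → ℝ) : Prop where
  continuousOn : ContinuousOn u Ω
  concaveOn : ConcaveOn ℝ Ω u
  eq_zero : ∀ p ∈ frontier Ω, u p = 0
  bounded_gradient : ∃ C : ℝ, ∀ p ∈ interior Ω,
    LineDifferentiableAt ℝ u p (1, 0) → LineDifferentiableAt ℝ u p (0, 1) →
      |partialX u p| ≤ C ∧ |partialY u p| ≤ C

/-- The norm `‖f‖_∞`: the essential supremum of `|f|` over `Ω`. -/
def supNorm (Ω : Set (ℝ × ℝ)) (f : ℝ × ℝ → ℝ) : ℝ≥0∞ :=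
  eLpNorm f ∞ (volume.restrict Ω)

/-- `K_∞(Ω) ∈ [0, ∞]`: the supremum of `‖u_x‖_∞ / ‖u_y‖_∞` over all `u ∈ 𝒰_Ω` that do not vanish
identically on `Ω`. -/
def KInfty (Ω : Set (ℝ × ℝ)) : ℝ≥0∞ :=
  ⨆ u ∈ {u : ℝ × ℝ → ℝ | MemU Ω u ∧ ∃ p ∈ Ω, u p ≠ 0},
    supNorm Ω (partialX u) / supNorm Ω (partialY u)

end

open Set Filter Topology MeasureTheory
open scoped ENNReal

theorem ConcaveOn.le_add_mul_lineDeriv {E : Type*} [AddCommGroup E] [Module ℝ E]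
    {s : Set E} {u : E → ℝ} (hu : ConcaveOn ℝ s u) {p e : E} {t : ℝ} (hp : p ∈ s)
    (hq : p + t • e ∈ s) (hd : LineDifferentiableAt ℝ u p e) :
    u (p + t • e) ≤ u p + t * lineDeriv ℝ u p e := by
  have h1 : HasDerivAt (fun r : ℝ => u (p + r • e)) (lineDeriv ℝ u p e) (t * 0) := by
    rw [mul_zero]; exact hd.hasDerivAt
  have h2 : HasDerivAt (fun r : ℝ => u (p + (t * r) • e)) (lineDeriv ℝ u p e * t) 0 := by
    have := h1.comp (0 : ℝ) ((hasDerivAt_id (0 : ℝ)).const_mul t)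
    simpa [Function.comp_def] using this
  have h3 := h2.hasDerivWithinAt (s := Ioi 0)
  rw [hasDerivWithinAt_iff_tendsto_slope' (by simp)] at h3
  have h4 : u (p + t • e) - u p ≤ lineDeriv ℝ u p e * t := by
    refine ge_of_tendsto h3 ?_
    filter_upwards [Ioo_mem_nhdsGT (zero_lt_one' ℝ)] with r hr
    have h5 := hu.2 hp hq (sub_nonneg.2 hr.2.le) hr.1.le (by ring)
    have h6 : (1 - r) • p + r • (p + t • e) = p + (t * r) • e := by module
    rw [h6] at h5
    simp only [smul_eq_mul] at h5
    rw [slope_def_field, le_div_iff₀ (by simpa using hr.1)]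
    simp only [mul_zero, zero_smul, add_zero, sub_zero]
    linarith
  linarith

theorem ConcaveOn.ae_differentiableAt_interior {E : Type*} [NormedAddCommGroup E]
    [NormedSpace ℝ E] [FiniteDimensional ℝ E] [MeasurableSpace E] [BorelSpace E]
    (μ : Measure E) [μ.IsAddHaarMeasure]
    {s : Set E} {u : E → ℝ} (hu : ConcaveOn ℝ s u) {q : E} (hq : q ∈ interior s) :
    ∃ U ∈ 𝓝 q, IsOpen U ∧ ∀ᵐ x ∂μ, x ∈ U → DifferentiableAt ℝ u x := by
  obtain ⟨K, t, ht, hK⟩ := hu.locallyLipschitzOn_interior hq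
  rw [isOpen_interior.nhdsWithin_eq hq] at ht
  obtain ⟨U, hUt, hU, hqU⟩ := mem_nhds_iff.1 ht
  refine ⟨U, hU.mem_nhds hqU, hU, ?_⟩
  filter_upwards [(hK.mono hUt).ae_differentiableWithinAt_of_mem (μ := μ)] with x hx hxU
  exact (hx hxU).differentiableAt (hU.mem_nhds hxU)

/-- The essential supremum of a directional derivative of a concave function bounds its
difference quotients in that direction. -/
theorem ConcaveOn.abs_sub_div_le_eLpNorm_lineDeriv {E : Type*} [NormedAddCommGroup E]
    [NormedSpace ℝ E] [FiniteDimensional ℝ E] [MeasurableSpace E] [BorelSpace E]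
    (μ : Measure E) [μ.IsAddHaarMeasure]
    {s : Set E} {u : E → ℝ} (hu : ConcaveOn ℝ s u) {p e : E} {t : ℝ} (ht : t ≠ 0)
    (hp : p ∈ interior s) (hq : p + t • e ∈ interior s) :
    ENNReal.ofReal (|u (p + t • e) - u p| / |t|) ≤
      eLpNorm (fun x => lineDeriv ℝ u x e) ∞ (μ.restrict s) := by
  wlog hlt : u (p + t • e) < u p generalizing p t
  · rcases (not_lt.1 hlt).eq_or_lt with h | h
    · simp [h]
    · have := this (p := p + t • e) (t := -t) (neg_ne_zero.2 ht) hq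
        (by simpa using hp) (by simpa using h)
      simpa [abs_sub_comm] using this
  have htp : 0 < |t| := abs_pos.2 ht
  have hcont : ContinuousOn u (interior s) := hu.locallyLipschitzOn_interior.continuousOn
  refine le_of_forall_lt fun c hc => ?_
  have hctop : c ≠ ⊤ := hc.ne_top
  lift c to NNReal using hctop
  have hc' : (c : ℝ) < |u (p + t • e) - u p| / |t| := by
    rw [← ENNReal.ofReal_coe_nnreal] at hc
    exact (ENNReal.ofReal_lt_ofReal_iff_of_nonneg c.2).1 hc
  rw [abs_of_neg (by linarith), lt_div_iff₀ htp] at hc'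
  obtain ⟨d, hcd, hd⟩ := exists_between hc'
  set q := p + t • e with hqdef
  have hpq : q - t • e = p := by simp [hqdef]
  obtain ⟨U, hU, -, hdiff⟩ := hu.ae_differentiableAt_interior μ hq
  have hev : ∀ᶠ x in 𝓝 q, x ∈ U ∧ x ∈ interior s ∧ x - t • e ∈ interior s ∧
      d < u (x - t • e) - u x := by
    have hshift : Tendsto (fun x => x - t • e) (𝓝 q) (𝓝 p) := by
      have : Continuous fun x : E => x - t • e := by fun_prop
      simpa [hpq] using this.tendsto q
    have h1 : Tendsto u (𝓝 q) (𝓝 (u q)) := hcont.continuousAt (isOpen_interior.mem_nhds hq)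
    have h2 : Tendsto u (𝓝 p) (𝓝 (u p)) := hcont.continuousAt (isOpen_interior.mem_nhds hp)
    have h3 := (h2.comp hshift).sub h1
    have h4 : d < u p - u q := by linarith
    filter_upwards [hU, isOpen_interior.mem_nhds hq,
      hshift.eventually (isOpen_interior.mem_nhds hp), h3.eventually (lt_mem_nhds h4)]
      with x a b c d using ⟨a, b, c, d⟩
  obtain ⟨V, hV, hVo, hqV⟩ := mem_nhds_iff.1 hev
  have hVs : V ⊆ s := fun x hx => interior_subset (hV hx).2.1
  have h0 : μ.restrict V ≠ 0 := by
    rw [Ne, Measure.restrict_eq_zero]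
    exact (hVo.measure_pos μ ⟨q, hqV⟩).ne'
  have hae : ∀ᵐ x ∂μ.restrict V, ‖lineDeriv ℝ u x e‖ₑ ≤
      eLpNorm (fun x => lineDeriv ℝ u x e) ∞ (μ.restrict s) := by
    rw [eLpNorm_exponent_top]
    exact ae_mono (Measure.restrict_mono_set μ hVs) ae_le_eLpNormEssSup
  have hae2 : ∀ᵐ x ∂μ.restrict V, x ∈ U → DifferentiableAt ℝ u x :=
    ae_restrict_of_ae hdiff
  have : (ae (μ.restrict V)).NeBot := ae_neBot.2 h0
  obtain ⟨x, hx1, hx2, hxV⟩ :=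
    (hae.and (hae2.and (ae_restrict_mem hVo.measurableSet))).exists
  refine lt_of_lt_of_le ?_ hx1
  obtain ⟨hxU, hxs, hxs', hxd⟩ := hV hxV
  have key := hu.le_add_mul_lineDeriv (e := e) (t := -t) (interior_subset hxs)
    (by simpa [sub_eq_add_neg] using interior_subset hxs') (hx2 hxU).lineDifferentiableAt
  rw [neg_smul, ← sub_eq_add_neg] at key
  have h5 : d < |t| * |lineDeriv ℝ u x e| := by
    rw [← abs_mul]
    have := neg_le_abs (t * lineDeriv ℝ u x e)
    linarith
  have h6 : (c : ℝ) < ‖lineDeriv ℝ u x e‖ := by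
    rw [Real.norm_eq_abs]
    refine lt_of_mul_lt_mul_left ?_ htp.le
    linarith
  rw [← ofReal_norm, ← ENNReal.ofReal_coe_nnreal]
  exact (ENNReal.ofReal_lt_ofReal_iff_of_nonneg c.2).2 h6

theorem preimage_add_left_frontier {s : Set (ℝ × ℝ)} (v : ℝ × ℝ) :
    (fun x => v + x) ⁻¹' frontier s = frontier ((fun x => v + x) ⁻¹' s) :=
  (Homeomorph.addLeft v).preimage_frontier s

theorem preimage_add_left_interior {s : Set (ℝ × ℝ)} (v : ℝ × ℝ) :
    (fun x => v + x) ⁻¹' interior s = interior ((fun x => v + x) ⁻¹' s) :=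
  (Homeomorph.addLeft v).preimage_interior s

/-- The concave function on `Ω` whose graph is the cone over `Ω` with apex of height one
above `v`. -/
noncomputable def coneFunction (Ω : Set (ℝ × ℝ)) (v p : ℝ × ℝ) : ℝ :=
  1 - gauge ((fun x => v + x) ⁻¹' Ω) (p - v)

section ConeFunction

variable {Ω : Set (ℝ × ℝ)} {v : ℝ × ℝ}

theorem translate_mem_nhds_zero (hv : v ∈ interior Ω) : (fun x => v + x) ⁻¹' Ω ∈ 𝓝 0 := by
  rw [← mem_interior_iff_mem_nhds, ← preimage_add_left_interior]
  simpa using hv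

theorem memU_coneFunction (hconvex : Convex ℝ Ω) (hv : v ∈ interior Ω) :
    MemU Ω (coneFunction Ω v) := by
  have hS := hconvex.translate_preimage_right v
  have hS0 := translate_mem_nhds_zero hv
  obtain ⟨K, hK⟩ := hS.lipschitz_gauge hS0
  have hK' : LipschitzWith K (coneFunction Ω v) := by
    refine LipschitzWith.of_dist_le_mul fun x y => ?_
    simp only [coneFunction, dist_sub_left]
    simpa using hK.dist_le_mul (x - v) (y - v)
  refine ⟨hK'.continuous.continuousOn, ⟨hconvex, fun x _ y _ a b ha hb hab => ?_⟩,
    fun p hp => ?_, ⟨K * ‖((1, 0) : ℝ × ℝ)‖ + K * ‖((0, 1) : ℝ × ℝ)‖, fun p _ _ _ => ?_⟩⟩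
  · have h1 : a • x + b • y - v = a • (x - v) + b • (y - v) := by
      have : v = (a + b) • v := by rw [hab, one_smul]
      conv_lhs => rw [this]
      module
    have h2 := gauge_add_le hS (absorbent_nhds_zero hS0) (a • (x - v)) (b • (y - v))
    rw [gauge_smul_of_nonneg ha, gauge_smul_of_nonneg hb] at h2
    simp only [coneFunction, h1, smul_eq_mul] at h2 ⊢
    nlinarith
  · have : p - v ∈ frontier ((fun x => v + x) ⁻¹' Ω) := by
      rw [← preimage_add_left_frontier]
      simpa using hp
    rw [coneFunction, (gauge_eq_one_iff_mem_frontier hS hS0).2 this, sub_self]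
  · have h1 := norm_lineDeriv_le_of_lipschitz ℝ (x₀ := p) (v := ((1, 0) : ℝ × ℝ)) hK'
    have h2 := norm_lineDeriv_le_of_lipschitz ℝ (x₀ := p) (v := ((0, 1) : ℝ × ℝ)) hK'
    rw [Real.norm_eq_abs] at h1 h2
    have h3 : 0 ≤ K * ‖((1, 0) : ℝ × ℝ)‖ := by positivity
    have h4 : 0 ≤ K * ‖((0, 1) : ℝ × ℝ)‖ := by positivity
    exact ⟨h1.trans (le_add_of_nonneg_right h4), h2.trans (le_add_of_nonneg_left h3)⟩

theorem supNorm_partialY_coneFunction_le (hconvex : Convex ℝ Ω) (hv : v ∈ interior Ω)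
    {δ : ℝ} (hδ : δ ≠ 0) (h1 : v + (0, δ) ∈ Ω) (h2 : v - (0, δ) ∈ Ω) :
    supNorm Ω (partialY (coneFunction Ω v)) ≤ ENNReal.ofReal (1 / |δ|) := by
  have hS := hconvex.translate_preimage_right v
  have hS0 := translate_mem_nhds_zero hv
  set S := (fun x => v + x) ⁻¹' Ω with hSdef
  have hg1 : gauge S (0, δ) ≤ 1 := gauge_le_one_of_mem h1
  have hg2 : gauge S (-(0, δ)) ≤ 1 :=
    gauge_le_one_of_mem (by simpa [hSdef, sub_eq_add_neg] using h2)
  have hr : ∀ r : ℝ, gauge S (r • (0, 1)) ≤ 1 / |δ| * |r| := by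
    intro r
    have key : ∀ (c : ℝ) (z : ℝ × ℝ), 0 ≤ c → gauge S z ≤ 1 → gauge S (c • z) ≤ c := by
      intro c z hc hz
      rw [gauge_smul_of_nonneg hc, smul_eq_mul]
      exact mul_le_of_le_one_right hc hz
    have habs : 1 / |δ| * |r| = |r / δ| := by rw [abs_div]; ring
    rw [habs]
    rcases le_total 0 (r / δ) with h | h
    · rw [abs_of_nonneg h]
      convert key _ _ h hg1 using 2
      ext <;> simp [hδ]
    · rw [abs_of_nonpos h]
      convert key _ _ (neg_nonneg.2 h) hg2 using 2
      ext <;> simp [hδ]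
  rw [supNorm, eLpNorm_exponent_top]
  refine eLpNormEssSup_le_of_ae_bound (Eventually.of_forall fun p => ?_)
  refine norm_deriv_le_of_lip' (by positivity) (Eventually.of_forall fun r => ?_)
  have ha := gauge_add_le hS (absorbent_nhds_zero hS0) (p - v) (r • (0, 1))
  have hb := gauge_add_le hS (absorbent_nhds_zero hS0) (p + r • (0, 1) - v) ((-r) • (0, 1))
  have e1 : p - v + r • ((0, 1) : ℝ × ℝ) = p + r • (0, 1) - v := by module
  have e2 : p + r • ((0, 1) : ℝ × ℝ) - v + (-r) • (0, 1) = p - v := by module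
  rw [e1] at ha
  rw [e2] at hb
  have hc := hr r
  have hd := hr (-r)
  rw [abs_neg] at hd
  simp only [coneFunction, zero_smul, add_zero, sub_zero, Real.norm_eq_abs]
  rw [abs_le]
  constructor <;> linarith

theorem le_supNorm_partialX_coneFunction (hconvex : Convex ℝ Ω) (hv : v ∈ interior Ω)
    {τ : ℝ} (hτ : v + (τ, 0) ∉ interior Ω) :
    ENNReal.ofReal (1 / |τ|) ≤ supNorm Ω (partialX (coneFunction Ω v)) := by
  have hS := hconvex.translate_preimage_right v
  have hS0 := translate_mem_nhds_zero hv
  have hτ0 : τ ≠ 0 := by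
    rintro rfl
    exact hτ (by simpa [Prod.mk_zero_zero] using hv)
  have hg : 1 ≤ gauge ((fun x => v + x) ⁻¹' Ω) (τ, 0) := by
    rw [← not_lt, gauge_lt_one_iff_mem_interior hS hS0, ← preimage_add_left_interior]
    exact hτ
  have hcont : Continuous fun r : ℝ => v + (r * τ) • ((1, 0) : ℝ × ℝ) := by fun_prop
  have hev : ∀ᶠ r in 𝓝[>] (0 : ℝ), v + (r * τ) • ((1, 0) : ℝ × ℝ) ∈ interior Ω :=
    nhdsWithin_le_nhds (hcont.continuousAt.preimage_mem_nhds
      (by simpa using isOpen_interior.mem_nhds hv))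
  obtain ⟨r, hr, hr0⟩ := (hev.and self_mem_nhdsWithin).exists
  replace hr0 : 0 < r := hr0
  have hE := (memU_coneFunction hconvex hv).concaveOn.abs_sub_div_le_eLpNorm_lineDeriv
    volume (mul_ne_zero hr0.ne' hτ0) hv hr
  refine le_trans (ENNReal.ofReal_le_ofReal ?_) hE
  have h1 : (r * τ) • ((1, 0) : ℝ × ℝ) = r • (τ, 0) := by ext <;> simp
  simp only [coneFunction, add_sub_cancel_left, sub_self, gauge_zero, h1,
    gauge_smul_of_nonneg hr0.le, smul_eq_mul]
  rw [abs_mul, abs_of_pos hr0, div_le_div_iff₀ (abs_pos.2 hτ0) (by positivity)]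
  have h2 : r * gauge ((fun x => v + x) ⁻¹' Ω) (τ, 0) ≤
      |1 - r * gauge ((fun x => v + x) ⁻¹' Ω) (τ, 0) - (1 - 0)| := by
    rw [abs_sub_comm]
    refine le_trans (le_of_eq ?_) (le_abs_self _)
    ring
  have h3 : r ≤ r * gauge ((fun x => v + x) ⁻¹' Ω) (τ, 0) := le_mul_of_one_le_right hr0.le hg
  have := mul_le_mul_of_nonneg_right (h3.trans h2) (abs_nonneg τ)
  linarith

end ConeFunction

/-- Lower bound for `K_∞` by the ratio of a vertical to a horizontal distance to the boundary. -/
theorem ofReal_div_le_KInfty {Ω : Set (ℝ × ℝ)} (hconvex : Convex ℝ Ω) {v : ℝ × ℝ}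
    (hv : v ∈ interior Ω) {δ τ : ℝ} (h1 : v + (0, δ) ∈ Ω) (h2 : v - (0, δ) ∈ Ω)
    (hτ : v + (τ, 0) ∉ interior Ω) : ENNReal.ofReal (|δ| / |τ|) ≤ KInfty Ω := by
  rcases eq_or_ne δ 0 with rfl | hδ
  · simp
  have hmem : coneFunction Ω v ∈ {u : ℝ × ℝ → ℝ | MemU Ω u ∧ ∃ p ∈ Ω, u p ≠ 0} :=
    ⟨memU_coneFunction hconvex hv, v, interior_subset hv, by simp [coneFunction]⟩
  refine le_trans ?_ (le_iSup₂_of_le _ hmem le_rfl)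
  refine le_trans ?_ (ENNReal.div_le_div (le_supNorm_partialX_coneFunction hconvex hv hτ)
    (supNorm_partialY_coneFunction_le hconvex hv hδ h1 h2))
  rw [← ENNReal.ofReal_div_of_pos (by positivity)]
  refine ENNReal.ofReal_le_ofReal (le_of_eq ?_)
  field_simp

theorem IsCompact.exists_add_smul_mem_frontier {E : Type*} [NormedAddCommGroup E]
    [NormedSpace ℝ E] {s : Set E} (hs : IsCompact s) {p e : E} (hp : p ∈ s) (he : e ≠ 0) :
    ∃ t : ℝ, 0 ≤ t ∧ p + t • e ∈ frontier s := by
  have hcl : IsClosedEmbedding fun t : ℝ => p + t • e :=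
    (Homeomorph.addLeft p).isClosedEmbedding.comp (isClosedEmbedding_smul_left he)
  have hK : IsCompact (((fun t : ℝ => p + t • e) ⁻¹' s) ∩ Ici 0) :=
    (hcl.isCompact_preimage hs).inter_right isClosed_Ici
  obtain ⟨t, ⟨hts, ht0⟩, hmax⟩ := hK.exists_isGreatest ⟨0, by simpa using hp, self_mem_Ici⟩
  refine ⟨t, ht0, subset_closure hts, fun hint => ?_⟩
  have hev : ∀ᶠ r in 𝓝[>] t, p + r • e ∈ s := by
    refine nhdsWithin_le_nhds (hcl.continuous.continuousAt.preimage_mem_nhds ?_)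
    exact mem_interior_iff_mem_nhds.1 hint
  obtain ⟨r, hr, hrt⟩ := (hev.and self_mem_nhdsWithin).exists
  have : t < r := hrt
  exact absurd (hmax ⟨hr, (le_trans ht0 this.le : (0 : ℝ) ≤ r)⟩) (not_le.2 this)

section UpperBound

variable {Ω : Set (ℝ × ℝ)} {u : ℝ × ℝ → ℝ}

/-- The height of `u` over an interior point is at most the vertical distance to the boundary
times the norm of `u_y`. -/
theorem MemU.abs_le_supNorm_partialY_mul (hcompact : IsCompact Ω) (hu : MemU Ω u) {p : ℝ × ℝ}
    (hp : p ∈ interior Ω) {δ : ℝ} (hδ : p + (0, δ) ∈ frontier Ω) :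
    ENNReal.ofReal (|u p| / |δ|) ≤ supNorm Ω (partialY u) := by
  have hconvex := hu.concaveOn.1
  have hδ0 : δ ≠ 0 := by
    rintro rfl
    rw [Prod.mk_zero_zero, add_zero] at hδ
    exact hδ.2 hp
  have hq : p + (0, δ) ∈ Ω := hcompact.isClosed.frontier_subset hδ
  have hin : ∀ r ∈ Ioo (0 : ℝ) 1, p + (r * δ) • ((0, 1) : ℝ × ℝ) ∈ interior Ω := by
    intro r hr
    refine hconvex.openSegment_interior_self_subset_interior hp hq
      ⟨1 - r, r, by linarith [hr.2], hr.1, by ring, ?_⟩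
    ext
    · simp; ring
    · simp; ring
  have hbound : ∀ᶠ r in 𝓝[<] (1 : ℝ),
      ENNReal.ofReal (|u (p + (r * δ) • (0, 1)) - u p| / |r * δ|) ≤ supNorm Ω (partialY u) := by
    filter_upwards [Ioo_mem_nhdsLT (zero_lt_one' ℝ)] with r hr
    exact hu.concaveOn.abs_sub_div_le_eLpNorm_lineDeriv volume
      (mul_ne_zero hr.1.ne' hδ0) hp (hin r hr)
  have hpath : Continuous fun r : ℝ => p + (r * δ) • ((0, 1) : ℝ × ℝ) := by fun_prop
  have hq' : p + ((1 : ℝ) * δ) • ((0, 1) : ℝ × ℝ) = p + (0, δ) := by ext <;> simp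
  have ht1 : Tendsto (fun r : ℝ => u (p + (r * δ) • (0, 1))) (𝓝[<] 1)
      (𝓝 (u (p + (0, δ)))) := by
    refine (hu.continuousOn _ hq).tendsto.comp (tendsto_nhdsWithin_iff.2 ⟨?_, ?_⟩)
    · rw [← hq']
      exact (hpath.tendsto 1).mono_left nhdsWithin_le_nhds
    · filter_upwards [Ioo_mem_nhdsLT (zero_lt_one' ℝ)] with r hr
      exact interior_subset (hin r hr)
  rw [hu.eq_zero _ hδ] at ht1
  have ht2 : Tendsto (fun r : ℝ => |r * δ|) (𝓝[<] 1) (𝓝 |δ|) := by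
    have : Continuous fun r : ℝ => |r * δ| := by fun_prop
    simpa using (this.tendsto 1).mono_left nhdsWithin_le_nhds
  have ht3 := ((ht1.sub_const (u p)).abs.div ht2 (abs_ne_zero.2 hδ0))
  simp only [zero_sub, abs_neg] at ht3
  exact le_of_tendsto (ENNReal.tendsto_ofReal ht3) hbound

theorem MemU.abs_partialX_mul_le (hcompact : IsCompact Ω) (hu : MemU Ω u) {p : ℝ × ℝ}
    (hp : p ∈ interior Ω) (hd : partialX u p ≠ 0) :
    ∃ τ : ℝ, τ ≠ 0 ∧ p + (τ, 0) ∈ frontier Ω ∧ |partialX u p| * |τ| ≤ u p := by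
  have hdiff : LineDifferentiableAt ℝ u p (1, 0) := by
    by_contra h
    exact hd (lineDeriv_zero_of_not_lineDifferentiableAt h)
  have he : ((-partialX u p, 0) : ℝ × ℝ) ≠ 0 := by simpa using hd
  obtain ⟨t, ht, htf⟩ := hcompact.exists_add_smul_mem_frontier (interior_subset hp) he
  have e1 : t • ((-partialX u p, 0) : ℝ × ℝ) = (-(t * partialX u p), 0) := by ext <;> simp
  rw [e1] at htf
  have ht0 : t ≠ 0 := by
    rintro rfl
    rw [zero_mul, neg_zero, Prod.mk_zero_zero, add_zero] at htf
    exact htf.2 hp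
  refine ⟨_, neg_ne_zero.2 (mul_ne_zero ht0 hd), htf, ?_⟩
  have e2 : p + (-(t * partialX u p)) • ((1, 0) : ℝ × ℝ) = p + (-(t * partialX u p), 0) := by
    ext <;> simp
  have key := hu.concaveOn.le_add_mul_lineDeriv (interior_subset hp)
    (by rw [e2]; exact hcompact.isClosed.frontier_subset htf) hdiff
  rw [e2, hu.eq_zero _ htf] at key
  change 0 ≤ u p + -(t * partialX u p) * partialX u p at key
  rw [abs_neg, abs_mul, abs_of_nonneg ht]
  have := abs_mul_abs_self (partialX u p)
  nlinarith

/-- Upper bound for `K_∞` by ratios of vertical to horizontal distances to the boundary. -/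
theorem KInfty_le_ofReal (hcompact : IsCompact Ω) {r : ℝ} (hr0 : 0 ≤ r)
    (hr : ∀ v ∈ interior Ω, ∀ τ : ℝ, τ ≠ 0 → v + (τ, 0) ∈ frontier Ω →
      ∃ δ : ℝ, v + (0, δ) ∈ frontier Ω ∧ |δ| ≤ r * |τ|) : KInfty Ω ≤ ENNReal.ofReal r := by
  refine iSup₂_le fun u hu => ?_
  replace hu := hu.1
  set Y := supNorm Ω (partialY u) with hY
  rcases eq_or_ne Y ⊤ with htop | htop
  · simp [htop]
  refine ENNReal.div_le_of_le_mul ?_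
  rw [supNorm, eLpNorm_exponent_top]
  refine eLpNormEssSup_le_of_ae_enorm_bound ?_
  have hfr : ∀ᵐ p ∂volume.restrict Ω, p ∉ frontier Ω :=
    ae_restrict_of_ae (measure_eq_zero_iff_ae_notMem.1 (hu.concaveOn.1.addHaar_frontier volume))
  filter_upwards [hfr, ae_restrict_mem hcompact.measurableSet] with p hpf hpΩ
  have hp : p ∈ interior Ω := by
    by_contra h
    exact hpf ⟨subset_closure hpΩ, h⟩
  rcases eq_or_ne (partialX u p) 0 with h0 | h0
  · simp [h0]
  obtain ⟨τ, hτ0, hτ, hle⟩ := hu.abs_partialX_mul_le hcompact hp h0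
  obtain ⟨δ, hδ, hδτ⟩ := hr p hp τ hτ0 hτ
  have hY' := hu.abs_le_supNorm_partialY_mul hcompact hp hδ
  rw [← hY, ← ENNReal.ofReal_toReal htop,
    ENNReal.ofReal_le_ofReal_iff ENNReal.toReal_nonneg] at hY'
  rw [← ENNReal.ofReal_toReal htop, ← ENNReal.ofReal_mul hr0, ← ofReal_norm, Real.norm_eq_abs]
  refine ENNReal.ofReal_le_ofReal ?_
  have hδ0 : δ ≠ 0 := by
    rintro rfl
    rw [Prod.mk_zero_zero, add_zero] at hδ
    exact hδ.2 hp
  have hτp : 0 < |τ| := abs_pos.2 hτ0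
  rw [div_le_iff₀ (abs_pos.2 hδ0)] at hY'
  refine le_of_mul_le_mul_right ?_ hτp
  have h1 := (hle.trans (le_abs_self _)).trans hY'
  have h2 := mul_le_mul_of_nonneg_left hδτ (ENNReal.toReal_nonneg (a := Y))
  linarith

end UpperBound

section OneSidedDerivatives

theorem EReal.abs_le_ofReal_of_tendsto {ι : Type*} {l : Filter ι} [l.NeBot] {f : ι → ℝ}
    {d : EReal} {k : ℝ} (hf : Tendsto (fun i => (f i : EReal)) l (𝓝 d))
    (hk : ∀ᶠ i in l, |f i| ≤ k) : d.abs ≤ ENNReal.ofReal k := by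
  have h1 : d ≤ (k : EReal) := le_of_tendsto hf (hk.mono fun i hi =>
    EReal.coe_le_coe_iff.2 (abs_le.1 hi).2)
  have h2 : ((-k : ℝ) : EReal) ≤ d := ge_of_tendsto hf (hk.mono fun i hi =>
    EReal.coe_le_coe_iff.2 (abs_le.1 hi).1)
  induction d with
  | bot => exact absurd h2 (not_le.2 (EReal.bot_lt_coe _))
  | top => exact absurd h1 (not_le.2 (EReal.coe_lt_top _))
  | coe d =>
    rw [EReal.abs_def]
    exact ENNReal.ofReal_le_ofReal
      (abs_le.2 ⟨EReal.coe_le_coe_iff.1 h2, EReal.coe_le_coe_iff.1 h1⟩)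

theorem abs_le_of_mem_oneSidedDerivatives {φ : ℝ → ℝ} {a b k : ℝ}
    (hk : ∀ x ∈ Icc a b, ∀ t ∈ Icc a b, |φ t - φ x| / |t - x| ≤ k) {d : EReal}
    (hd : d ∈ oneSidedDerivatives φ a b) : d.abs ≤ ENNReal.ofReal k := by
  rcases hd with ⟨x, hx, h⟩ | ⟨x, hx, h⟩
  · refine EReal.abs_le_ofReal_of_tendsto h ?_
    filter_upwards [Ioo_mem_nhdsGT hx.2] with t ht
    rw [abs_div]
    exact hk x ⟨hx.1, hx.2.le⟩ t ⟨hx.1.trans ht.1.le, ht.2.le⟩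
  · refine EReal.abs_le_ofReal_of_tendsto h ?_
    filter_upwards [Ioo_mem_nhdsLT hx.1] with t ht
    rw [abs_div]
    exact hk x ⟨hx.1.le, hx.2⟩ t ⟨ht.1.le, ht.2.le.trans hx.2⟩

theorem neg_mem_oneSidedDerivatives {φ : ℝ → ℝ} {a b : ℝ} {d : EReal}
    (hd : d ∈ oneSidedDerivatives φ a b) : -d ∈ oneSidedDerivatives (fun x => -φ x) a b := by
  have key : ∀ x t : ℝ, (((-φ t - -φ x) / (t - x) : ℝ) : EReal) =
      -(((φ t - φ x) / (t - x) : ℝ) : EReal) := by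
    intro x t
    rw [← EReal.coe_neg]
    congr 1
    ring
  have hneg := fun l : Filter ℝ => fun x : ℝ => fun
    (h : Tendsto (fun t => (((φ t - φ x) / (t - x) : ℝ) : EReal)) l (𝓝 d)) =>
      (continuous_neg.tendsto d).comp h
  rcases hd with ⟨x, hx, h⟩ | ⟨x, hx, h⟩
  · exact Or.inl ⟨x, hx, by simpa only [key, Function.comp_def] using hneg _ x h⟩
  · exact Or.inr ⟨x, hx, by simpa only [key, Function.comp_def] using hneg _ x h⟩

/-- A one-sided derivative of a concave function at `x` is at least as steep as any secant
ascending from `x`. -/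
theorem ConcaveOn.exists_mem_oneSidedDerivatives {ψ : ℝ → ℝ} {a b x t : ℝ}
    (hψ : ConcaveOn ℝ (Icc a b) ψ) (hx : x ∈ Icc a b) (ht : t ∈ Icc a b) (hlt : ψ x < ψ t) :
    ∃ d ∈ oneSidedDerivatives ψ a b, ENNReal.ofReal (|ψ t - ψ x| / |t - x|) ≤ d.abs := by
  have hanti := hψ.slope_anti hx
  have hcoe : Monotone ((↑) : ℝ → EReal) := fun _ _ h => EReal.coe_le_coe_iff.2 h
  have habs : ∀ (s : ℝ) (d : EReal), 0 ≤ s → (s : EReal) ≤ d → ENNReal.ofReal s ≤ d.abs := by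
    intro s d hs hd
    induction d with
    | bot => exact absurd hd (not_le.2 (EReal.bot_lt_coe _))
    | top => exact le_top
    | coe d =>
      rw [EReal.abs_def]
      exact ENNReal.ofReal_le_ofReal ((EReal.coe_le_coe_iff.1 hd).trans (le_abs_self d))
  have hne : t ≠ x := by
    rintro rfl
    exact lt_irrefl _ hlt
  rw [← abs_div]
  rcases hne.lt_or_gt with h | h
  · have hmono : AntitoneOn (fun r => ((slope ψ x r : ℝ) : EReal)) (Ioo a x) :=
      fun r hr s hs hrs => hcoe (hanti ⟨⟨hr.1.le, hr.2.le.trans hx.2⟩, hr.2.ne⟩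
        ⟨⟨hs.1.le, hs.2.le.trans hx.2⟩, hs.2.ne⟩ hrs)
    have hax : a < x := ht.1.trans_lt h
    have hlim := hmono.tendsto_nhdsWithin_Ioo_left (nonempty_Ioo.2 hax) (OrderBot.bddBelow _)
    generalize sInf (_ : Set EReal) = d at hlim
    refine ⟨_, Or.inr ⟨x, ⟨hax, hx.2⟩, by simpa only [slope_def_field] using hlim⟩, ?_⟩
    rw [← EReal.abs_neg, abs_of_nonpos
      (div_nonpos_of_nonneg_of_nonpos (sub_nonneg.2 hlt.le) (sub_nonpos.2 h.le))]
    refine habs _ _ ?_ ?_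
    · rw [neg_nonneg]
      exact div_nonpos_of_nonneg_of_nonpos (sub_nonneg.2 hlt.le) (sub_nonpos.2 h.le)
    · rw [EReal.coe_neg, EReal.neg_le_neg_iff]
      refine le_of_tendsto hlim ?_
      filter_upwards [Ioo_mem_nhdsLT h] with r hr
      rw [← slope_def_field]
      exact hcoe (hanti ⟨ht, hne⟩ ⟨⟨ht.1.trans hr.1.le, hr.2.le.trans hx.2⟩, hr.2.ne⟩ hr.1.le)
  · have hmono : AntitoneOn (fun r => ((slope ψ x r : ℝ) : EReal)) (Ioo x b) :=
      fun r hr s hs hrs => hcoe (hanti ⟨⟨hx.1.trans hr.1.le, hr.2.le⟩, hr.1.ne'⟩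
        ⟨⟨hx.1.trans hs.1.le, hs.2.le⟩, hs.1.ne'⟩ hrs)
    have hxb : x < b := h.trans_le ht.2
    have hlim := hmono.tendsto_nhdsWithin_Ioo_right (nonempty_Ioo.2 hxb) (OrderTop.bddAbove _)
    generalize sSup (_ : Set EReal) = d at hlim
    refine ⟨_, Or.inl ⟨x, ⟨hx.1, hxb⟩, by simpa only [slope_def_field] using hlim⟩, ?_⟩
    rw [abs_of_nonneg (div_nonneg (sub_nonneg.2 hlt.le) (sub_nonneg.2 h.le))]
    refine habs _ _ (div_nonneg (sub_nonneg.2 hlt.le) (sub_nonneg.2 h.le)) ?_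
    refine ge_of_tendsto hlim ?_
    filter_upwards [Ioo_mem_nhdsGT h] with r hr
    rw [← slope_def_field]
    exact hcoe (hanti ⟨⟨hx.1.trans hr.1.le, hr.2.le.trans ht.2⟩, hr.1.ne'⟩ ⟨ht, hne⟩ hr.2.le)

end OneSidedDerivatives

section Projection

variable {Ω : Set (ℝ × ℝ)}

theorem lt_of_mem_interior_of_forall_le {α β c : ℝ} (hne : (α, β) ≠ (0, 0))
    (h : ∀ p ∈ Ω, α * p.1 + β * p.2 ≤ c) {q : ℝ × ℝ} (hq : q ∈ interior Ω) :
    α * q.1 + β * q.2 < c := by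
  have hcont : Continuous fun r : ℝ => q + r • (α, β) := by fun_prop
  have hev : ∀ᶠ r in 𝓝[>] (0 : ℝ), q + r • (α, β) ∈ interior Ω :=
    nhdsWithin_le_nhds (hcont.continuousAt.preimage_mem_nhds
      (by simpa using isOpen_interior.mem_nhds hq))
  obtain ⟨r, hr, hr0⟩ := (hev.and self_mem_nhdsWithin).exists
  replace hr0 : 0 < r := hr0
  have h1 := h _ (interior_subset hr)
  simp only [Prod.fst_add, Prod.snd_add, Prod.smul_fst, Prod.smul_snd, smul_eq_mul] at h1
  have h2 : 0 < α ^ 2 + β ^ 2 := by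
    rcases eq_or_ne α 0 with rfl | hα
    · have : β ≠ 0 := by simpa using hne
      positivity
    · positivity
  nlinarith [mul_pos hr0 h2]

theorem isCompact_image_fst (hcompact : IsCompact Ω) : IsCompact (Prod.fst '' Ω) :=
  hcompact.image continuous_fst

theorem fst_mem_Icc (hcompact : IsCompact Ω) {p : ℝ × ℝ} (hp : p ∈ Ω) :
    p.1 ∈ Icc (leftEnd Ω) (rightEnd Ω) :=
  ⟨csInf_le (isCompact_image_fst hcompact).bddBelow (mem_image_of_mem _ hp),
    le_csSup (isCompact_image_fst hcompact).bddAbove (mem_image_of_mem _ hp)⟩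

theorem exists_mem_of_mem_Icc (hconvex : Convex ℝ Ω) (hcompact : IsCompact Ω)
    (hne : Ω.Nonempty) {x : ℝ} (hx : x ∈ Icc (leftEnd Ω) (rightEnd Ω)) : ∃ y, (x, y) ∈ Ω := by
  have hconv : Convex ℝ (Prod.fst '' Ω) := hconvex.is_linear_image (LinearMap.fst ℝ ℝ ℝ).isLinear
  have hK := isCompact_image_fst hcompact
  obtain ⟨p, hp, hpx⟩ := hconv.ordConnected.out (hK.sInf_mem (hne.image _))
    (hK.sSup_mem (hne.image _)) hx
  exact ⟨p.2, by rw [← hpx]; exact hp⟩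

theorem fst_mem_Ioo (hcompact : IsCompact Ω) {p : ℝ × ℝ} (hp : p ∈ interior Ω) :
    p.1 ∈ Ioo (leftEnd Ω) (rightEnd Ω) := by
  have h1 := lt_of_mem_interior_of_forall_le (α := -1) (β := 0) (c := -leftEnd Ω) (by simp)
    (fun q hq => by linarith [(fst_mem_Icc hcompact hq).1]) hp
  have h2 := lt_of_mem_interior_of_forall_le (α := 1) (β := 0) (c := rightEnd Ω) (by simp)
    (fun q hq => by linarith [(fst_mem_Icc hcompact hq).2]) hp
  constructor <;> linarith

theorem exists_mem_interior_of_mem_Ioo (hconvex : Convex ℝ Ω) (hcompact : IsCompact Ω)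
    (hint : (interior Ω).Nonempty) {x : ℝ} (hx : x ∈ Ioo (leftEnd Ω) (rightEnd Ω)) :
    ∃ y, (x, y) ∈ interior Ω := by
  obtain ⟨w, hw⟩ := hint
  have hne : Ω.Nonempty := ⟨w, interior_subset hw⟩
  have hlr := (hx.1.trans hx.2).le
  have key : ∀ e ∈ Icc (leftEnd Ω) (rightEnd Ω), x ∈ openSegment ℝ w.1 e →
      ∃ y, (x, y) ∈ interior Ω := by
    rintro e he ⟨s, t, hs, ht, hst, hxe⟩
    obtain ⟨y, hy⟩ := exists_mem_of_mem_Icc hconvex hcompact hne he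
    refine ⟨s * w.2 + t * y, hconvex.openSegment_interior_self_subset_interior hw hy
      ⟨s, t, hs, ht, hst, ?_⟩⟩
    ext
    · simpa using hxe
    · simp
  rcases lt_trichotomy x w.1 with h | h | h
  · refine key _ (left_mem_Icc.2 hlr) ?_
    rw [openSegment_symm, openSegment_eq_Ioo (hx.1.trans h)]
    exact ⟨hx.1, h⟩
  · exact ⟨w.2, by rw [h]; exact hw⟩
  · refine key _ (right_mem_Icc.2 hlr) ?_
    rw [openSegment_eq_Ioo (h.trans hx.2)]
    exact ⟨h, hx.2⟩

end Projection

/-- `Ω` lies in a nonvertical double cone with vertex `(c, η) ∈ Ω` and slope `C`. -/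
def HasConeAt (Ω : Set (ℝ × ℝ)) (c η C : ℝ) : Prop :=
  (c, η) ∈ Ω ∧ ∀ p ∈ Ω, |p.2 - η| ≤ C * |p.1 - c|

section SupportLines

variable {Ω : Set (ℝ × ℝ)}

theorem IsSupportLine.vertical_side {c : ℝ} (h : IsSupportLine Ω (verticalLine c)) :
    ∃ ε : ℝ, |ε| = 1 ∧ (∀ p ∈ Ω, 0 ≤ ε * (p.1 - c)) ∧ ∃ η, (c, η) ∈ Ω := by
  obtain ⟨α, β, d, hne, hline, hside, ⟨q, hq, hqΩ⟩⟩ := h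
  have hmem : ∀ y : ℝ, α * c + β * y = d := by
    intro y
    have : ((c, y) : ℝ × ℝ) ∈ verticalLine c := rfl
    rw [hline] at this
    exact this
  have hβ : β = 0 := by linarith [hmem 0, hmem 1]
  have hα : α ≠ 0 := by
    rintro rfl
    exact hne (by rw [hβ])
  subst hβ
  have hd := hmem 0
  refine ⟨-(α / |α|), by rw [abs_neg, abs_div, abs_abs, div_self (abs_ne_zero.2 hα)],
    fun p hp => ?_, q.2, ?_⟩
  · have h1 := hside p hp
    have h2 : -(α / |α|) * (p.1 - c) = (α * c - α * p.1) / |α| := by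
      field_simp
      ring
    rw [h2]
    exact div_nonneg (by linarith) (abs_nonneg α)
  · have : q.1 = c := hq
    rw [← this]
    exact hqΩ

theorem isSupportLine_verticalLine_leftEnd (hcompact : IsCompact Ω) (hne : Ω.Nonempty) :
    IsSupportLine Ω (verticalLine (leftEnd Ω)) := by
  obtain ⟨p, hp, hpx⟩ := (isCompact_image_fst hcompact).sInf_mem (hne.image _)
  refine ⟨-1, 0, -leftEnd Ω, by simp, ?_, fun q hq => ?_, p, hpx, hp⟩
  · ext q
    simp [verticalLine]
  · linarith [(fst_mem_Icc hcompact hq).1]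

theorem isSupportLine_verticalLine_rightEnd (hcompact : IsCompact Ω) (hne : Ω.Nonempty) :
    IsSupportLine Ω (verticalLine (rightEnd Ω)) := by
  obtain ⟨p, hp, hpx⟩ := (isCompact_image_fst hcompact).sSup_mem (hne.image _)
  refine ⟨1, 0, rightEnd Ω, by simp, ?_, fun q hq => ?_, p, hpx, hp⟩
  · ext q
    simp [verticalLine]
  · linarith [(fst_mem_Icc hcompact hq).2]

theorem IsAngularSupportLine.exists_hasConeAt (hcompact : IsCompact Ω) {c : ℝ}
    (h : IsAngularSupportLine Ω (verticalLine c)) : ∃ η C, HasConeAt Ω c η C := by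
  obtain ⟨-, ξ, hξ, hcap⟩ := h
  have hξΩ : ξ ∈ Ω := hcompact.isClosed.frontier_subset hξ.1
  have hξc : ξ.1 = c := (hcap.symm.subset (mem_singleton ξ)).1
  have key : ∀ s : ℝ, s ≠ 0 → ∃ α β : ℝ, 0 < β * s ∧
      ∀ p ∈ Ω, α * p.1 + β * p.2 ≤ α * ξ.1 + β * ξ.2 := by
    intro s hs
    have hnot : (c, ξ.2 + s) ∉ tangentConeWithVertex Ω ξ := by
      intro hmem
      have h1 : ((c, ξ.2 + s) : ℝ × ℝ) ∈ ({ξ} : Set (ℝ × ℝ)) := hcap ▸ ⟨rfl, hmem⟩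
      have h2 := congrArg Prod.snd (mem_singleton_iff.1 h1)
      simp at h2
      exact hs h2
    simp only [tangentConeWithVertex, mem_ofPred_eq, not_forall, not_le] at hnot
    obtain ⟨α, β, -, hside, hlt⟩ := hnot
    exact ⟨α, β, by rw [hξc] at hlt; linarith, hside⟩
  obtain ⟨α, β, hβ, hup⟩ := key 1 one_ne_zero
  obtain ⟨α', β', hβ', hdown⟩ := key (-1) (by norm_num)
  have hβ0 : 0 < β := by linarith
  have hβ0' : 0 < -β' := by linarith
  refine ⟨ξ.2, max (|α| / β) (|α'| / (-β')), by rw [← hξc]; exact hξΩ, fun p hp => ?_⟩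
  have h1 := hup p hp
  have h2 := hdown p hp
  rw [hξc] at h1 h2
  have h3 : |α| / β * |p.1 - c| ≤ max (|α| / β) (|α'| / (-β')) * |p.1 - c| :=
    mul_le_mul_of_nonneg_right (le_max_left _ _) (abs_nonneg _)
  have h4 : |α'| / (-β') * |p.1 - c| ≤ max (|α| / β) (|α'| / (-β')) * |p.1 - c| :=
    mul_le_mul_of_nonneg_right (le_max_right _ _) (abs_nonneg _)
  have h5 : p.2 - ξ.2 ≤ |α| / β * |p.1 - c| := by
    rw [div_mul_eq_mul_div, le_div_iff₀ hβ0, ← abs_mul]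
    linarith [neg_le_abs (α * (p.1 - c))]
  have h6 : -(p.2 - ξ.2) ≤ |α'| / (-β') * |p.1 - c| := by
    rw [div_mul_eq_mul_div, le_div_iff₀ hβ0', ← abs_mul]
    linarith [neg_le_abs (α' * (p.1 - c))]
  exact abs_le.2 ⟨by linarith, by linarith⟩

theorem HasConeAt.isAngularSupportLine {c η C : ℝ} (h : HasConeAt Ω c η C)
    (hline : IsSupportLine Ω (verticalLine c)) : IsAngularSupportLine Ω (verticalLine c) := by
  obtain ⟨ε, hε, hside, -⟩ := hline.vertical_side
  have habs : ∀ p ∈ Ω, |p.1 - c| = ε * (p.1 - c) := fun p hp => by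
    rw [← abs_of_nonneg (hside p hp), abs_mul, hε, one_mul]
  have hup : ∀ p ∈ Ω, -(C * ε) * p.1 + 1 * p.2 ≤ -(C * ε) * c + 1 * η := fun p hp => by
    have := (abs_le.1 (h.2 p hp)).2
    rw [habs p hp] at this
    linarith
  have hdown : ∀ p ∈ Ω, -(C * ε) * p.1 + -1 * p.2 ≤ -(C * ε) * c + -1 * η := fun p hp => by
    have := (abs_le.1 (h.2 p hp)).1
    rw [habs p hp] at this
    linarith
  refine ⟨hline, (c, η), ⟨⟨subset_closure h.1, fun hint => ?_⟩, ?_⟩, ?_⟩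
  · exact lt_irrefl _ (lt_of_mem_interior_of_forall_le (by simp) hup hint)
  · rintro ⟨ℓ, -, huniq⟩
    have h1 := huniq _ ⟨hline, rfl⟩
    have h2 := huniq {p | -(C * ε) * p.1 + 1 * p.2 = -(C * ε) * c + 1 * η}
      ⟨⟨_, _, _, by simp, rfl, hup, (c, η), rfl, h.1⟩, rfl⟩
    have h3 : ((c, η + 1) : ℝ × ℝ) ∈ verticalLine c := rfl
    rw [h1, ← h2] at h3
    have h4 : -(C * ε) * c + 1 * (η + 1) = -(C * ε) * c + 1 * η := h3
    linarith
  · ext q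
    constructor
    · rintro ⟨hq1, hq2⟩
      have hq1 : q.1 = c := hq1
      have h1 := hq2 _ _ (by simp) hup
      have h2 := hq2 _ _ (by simp) hdown
      simp only [hq1] at h1 h2
      exact Prod.ext hq1 (by simp only; linarith)
    · rintro rfl
      exact ⟨rfl, fun _ _ _ _ => le_rfl⟩

/-- If `Ω` lies in no nonvertical cone with vertex on a vertical line of support, then
`K_∞(Ω) = ∞`. -/
theorem KInfty_eq_top_of_forall_not_hasConeAt (hconvex : Convex ℝ Ω)
    (hint : (interior Ω).Nonempty) {c : ℝ} (hline : IsSupportLine Ω (verticalLine c))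
    (hcone : ∀ η C, ¬ HasConeAt Ω c η C) : KInfty Ω = ⊤ := by
  obtain ⟨ε, hε, hside, η, hη⟩ := hline.vertical_side
  obtain ⟨w, hw⟩ := hint
  have hε0 : ε ≠ 0 := by
    rintro rfl
    simp at hε
  have hpos : ∀ q ∈ interior Ω, 0 < ε * (q.1 - c) := fun q hq => by
    have := lt_of_mem_interior_of_forall_le (α := -ε) (β := 0) (c := -ε * c) (by simpa using hε0)
      (fun p hp => by linarith [hside p hp]) hq
    linarith
  refine ENNReal.eq_top_of_forall_nnreal_le fun N => ?_
  set D := w.1 - c with hD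
  set W := w.2 - η with hW
  have hD0 : D ≠ 0 := right_ne_zero_of_mul (hpos w hw).ne'
  have hnot := hcone η (2 * N + |W / D|)
  simp only [HasConeAt, hη, true_and, not_forall, not_le] at hnot
  obtain ⟨p, hp, hlt⟩ := hnot
  -- Moving `p` slightly towards `w` makes it interior and keeps the strict inequality.
  have hcont : Continuous fun r : ℝ => |(p + r • (w - p)).2 - η| -
      (2 * N + |W / D|) * |(p + r • (w - p)).1 - c| := by fun_prop
  have hev : ∀ᶠ r in 𝓝[>] (0 : ℝ), 0 < |(p + r • (w - p)).2 - η| -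
      (2 * N + |W / D|) * |(p + r • (w - p)).1 - c| := by
    refine nhdsWithin_le_nhds (hcont.continuousAt.eventually (lt_mem_nhds ?_))
    simpa using hlt
  obtain ⟨r, hr, hr0⟩ := (hev.and (Ioo_mem_nhdsGT (zero_lt_one' ℝ))).exists
  have hzint : p + r • (w - p) ∈ interior Ω :=
    hconvex.openSegment_self_interior_subset_interior hp hw
      ⟨1 - r, r, by linarith [hr0.2], hr0.1, by ring, by module⟩
  set z := p + r • (w - p) with hz
  set s := z.1 - c with hs
  set h := z.2 - η with hh
  have hs0 : s ≠ 0 := right_ne_zero_of_mul (hpos z hzint).ne'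
  have hsD : 0 < s * D := by
    have := mul_pos (hpos z hzint) (hpos w hw)
    have e : ε * (z.1 - c) * (ε * (w.1 - c)) = ε ^ 2 * (s * D) := by rw [hs, hD]; ring
    rw [e, ← sq_abs, hε, one_pow, one_mul] at this
    exact this
  have hsum : D + s ≠ 0 := by
    intro h0
    rw [eq_neg_of_add_eq_zero_left h0] at hsD
    nlinarith [sq_nonneg s]
  set lam := D / (D + s) with hlam
  set kap := s / (D + s) with hkap
  have hlk : lam + kap = 1 := by rw [hlam, hkap]; field_simp
  have hlam0 : 0 < lam := by
    have e : lam = (D * D + s * D) / (D + s) ^ 2 := by rw [hlam]; field_simp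
    rw [e]
    have := mul_self_nonneg D
    positivity
  have hkap0 : 0 < kap := by
    have e : kap = (s * s + s * D) / (D + s) ^ 2 := by rw [hkap]; field_simp; ring
    rw [e]
    have := mul_self_nonneg s
    positivity
  have hy : lam • z + kap • w ∈ interior Ω :=
    hconvex.interior hzint hw hlam0.le hkap0.le hlk
  have hv : (3 / 4 : ℝ) • ((c, η) : ℝ × ℝ) + (1 / 4 : ℝ) • (lam • z + kap • w) ∈ interior Ω :=
    hconvex.openSegment_self_interior_subset_interior hη hy
      ⟨3 / 4, 1 / 4, by norm_num, by norm_num, by norm_num, rfl⟩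
  have hz1 : z.1 = c + s := by rw [hs]; ring
  have hz2 : z.2 = η + h := by rw [hh]; ring
  have hw1 : w.1 = c + D := by rw [hD]; ring
  have hw2 : w.2 = η + W := by rw [hW]; ring
  have hkap' : kap = 1 - lam := by linarith
  have hup : (3 / 4 : ℝ) • ((c, η) : ℝ × ℝ) + (1 / 4 : ℝ) • (lam • z + kap • w) +
      (0, (lam * h - kap * W) / 4) ∈ Ω := by
    have h1 := hconvex hη (interior_subset hzint) (a := 1 - lam / 2) (b := lam / 2)
      (by linarith) (by linarith) (by ring)
    convert h1 using 1
    have hsl : kap * D = lam * s := by rw [hlam, hkap]; ring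
    ext
    · simp only [Prod.fst_add, Prod.smul_fst, smul_eq_mul, hz1, hw1]
      linear_combination (1 / 4) * hsl + (1 / 4) * c * hlk
    · simp only [Prod.snd_add, Prod.smul_snd, smul_eq_mul, hz2, hw2]
      linear_combination (1 / 4) * η * hlk
  have hdown : (3 / 4 : ℝ) • ((c, η) : ℝ × ℝ) + (1 / 4 : ℝ) • (lam • z + kap • w) -
      (0, (lam * h - kap * W) / 4) ∈ Ω := by
    have h1 := hconvex hη (interior_subset hw) (a := 1 - kap / 2) (b := kap / 2)
      (by linarith) (by linarith) (by ring)
    convert h1 using 1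
    have hsl : kap * D = lam * s := by rw [hlam, hkap]; ring
    ext
    · simp only [Prod.fst_sub, Prod.fst_add, Prod.smul_fst, smul_eq_mul, hz1, hw1]
      linear_combination -(1 / 4) * hsl + (1 / 4) * c * hlk
    · simp only [Prod.snd_sub, Prod.snd_add, Prod.smul_snd, smul_eq_mul, hz2, hw2]
      linear_combination (1 / 4) * η * hlk
  have hout : (3 / 4 : ℝ) • ((c, η) : ℝ × ℝ) + (1 / 4 : ℝ) • (lam • z + kap • w) +
      (-(lam * s + kap * D) / 4, 0) ∉ interior Ω := by
    intro hmem
    have h1 := hpos _ hmem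
    have e : ((3 / 4 : ℝ) • ((c, η) : ℝ × ℝ) + (1 / 4 : ℝ) • (lam • z + kap • w) +
      (-(lam * s + kap * D) / 4, 0)).1 = c := by
      simp only [Prod.fst_add, Prod.smul_fst, smul_eq_mul, hz1, hw1]
      linear_combination (1 / 4) * c * hlk
    rw [e] at h1
    simp at h1
  refine le_trans ?_ (ofReal_div_le_KInfty hconvex hv hup hdown hout)
  rw [← ENNReal.ofReal_coe_nnreal]
  refine ENNReal.ofReal_le_ofReal ?_
  have e1 : |(lam * h - kap * W) / 4| / |-(lam * s + kap * D) / 4| = |h / s - W / D| / 2 := by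
    rw [← abs_div]
    have : (lam * h - kap * W) / 4 / (-(lam * s + kap * D) / 4) = -((h / s - W / D) / 2) := by
      rw [hlam, hkap]
      field_simp
      ring
    rw [this, abs_neg, abs_div, abs_two]
  rw [e1]
  have h1 : 2 * N + |W / D| < |h / s| := by
    rw [abs_div h s, lt_div_iff₀ (abs_pos.2 hs0)]
    linarith
  have h2 := abs_sub_abs_le_abs_sub (h / s) (W / D)
  linarith

end SupportLines

theorem ofReal_slope_le_KInfty_of_interior {Ω : Set (ℝ × ℝ)} (hconvex : Convex ℝ Ω)
    {P Q w : ℝ × ℝ} (hP : P ∈ Ω) (hP' : P ∉ interior Ω) (hQ : Q ∈ Ω) (hw : w ∈ interior Ω)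
    (hwP : w.1 = P.1) (hneg : (w.2 - P.2) * (Q.2 - P.2) < 0) :
    ENNReal.ofReal (|Q.2 - P.2| / |Q.1 - P.1|) ≤ KInfty Ω := by
  have hQP : Q.2 - P.2 ≠ 0 := right_ne_zero_of_mul hneg.ne
  set μ := (w.2 - P.2) / (2 * (P.2 - Q.2)) with hμ
  have hμ0 : 0 < μ := by
    have e : μ = -((w.2 - P.2) * (Q.2 - P.2)) / (2 * (Q.2 - P.2) ^ 2) := by
      have : P.2 - Q.2 ≠ 0 := fun h => hQP (by linarith)
      rw [hμ]
      field_simp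
      ring
    rw [e]
    have : 0 < (Q.2 - P.2) ^ 2 := by positivity
    exact div_pos (by linarith) (by linarith)
  have hμ2 : μ * (Q.2 - P.2) = -((w.2 - P.2) / 2) := by
    have : P.2 - Q.2 ≠ 0 := fun h => hQP (by linarith)
    rw [hμ]
    field_simp
    ring
  have hv : (1 / 2 : ℝ) • w + (1 / 2 : ℝ) • P ∈ interior Ω :=
    hconvex.openSegment_interior_self_subset_interior hw hP
      ⟨1 / 2, 1 / 2, by norm_num, by norm_num, by norm_num, rfl⟩
  have hup : (1 / 2 : ℝ) • w + (1 / 2 : ℝ) • P + (0, (w.2 - P.2) / 2) ∈ Ω := by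
    convert interior_subset hw using 1
    ext
    · simp [hwP]
      ring
    · simp
      ring
  have hdown : (1 / 2 : ℝ) • w + (1 / 2 : ℝ) • P - (0, (w.2 - P.2) / 2) ∈ Ω := by
    convert hP using 1
    ext
    · simp [hwP]
      ring
    · simp
      ring
  have hout : (1 / 2 : ℝ) • w + (1 / 2 : ℝ) • P + (-(μ * (Q.1 - P.1)), 0) ∉ interior Ω := by
    intro hmem
    refine hP' (hconvex.openSegment_interior_self_subset_interior hmem hQ
      ⟨1 / (1 + μ), μ / (1 + μ), by positivity, by positivity, by field_simp, ?_⟩)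
    ext
    · simp [hwP]
      field_simp
      ring
    · simp
      field_simp
      linarith
  refine le_trans (ENNReal.ofReal_le_ofReal (le_of_eq ?_))
    (ofReal_div_le_KInfty hconvex hv hup hdown hout)
  rw [← abs_neg ((w.2 - P.2) / 2), ← hμ2, abs_neg, abs_mul, abs_mul,
    mul_div_mul_left _ _ (abs_pos.2 hμ0.ne').ne']

/-- `φ` is the upper (`σ = 1`) or lower (`σ = -1`) boundary function of `Ω`. -/
structure IsBoundaryGraph (Ω : Set (ℝ × ℝ)) (σ : ℝ) (φ : ℝ → ℝ) : Prop where
  sign : σ = 1 ∨ σ = -1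
  mem : ∀ x ∈ Icc (leftEnd Ω) (rightEnd Ω), (x, φ x) ∈ Ω
  extremal : ∀ p ∈ Ω, σ * p.2 ≤ σ * φ p.1

section Sections

variable {Ω : Set (ℝ × ℝ)}

theorem isCompact_section (hcompact : IsCompact Ω) (x : ℝ) : IsCompact {y | (x, y) ∈ Ω} := by
  have : IsClosedEmbedding fun y : ℝ => (x, y) :=
    ⟨isEmbedding_prodMkRight x, by
      have : range (fun y : ℝ => (x, y)) = {p : ℝ × ℝ | p.1 = x} := by
        ext p
        constructor
        · rintro ⟨y, rfl⟩
          rfl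
        · rintro rfl
          exact ⟨p.2, rfl⟩
      rw [this]
      exact isClosed_eq continuous_fst continuous_const⟩
  exact this.isCompact_preimage hcompact

theorem isBoundaryGraph_upperBoundary (hconvex : Convex ℝ Ω) (hcompact : IsCompact Ω)
    (hne : Ω.Nonempty) : IsBoundaryGraph Ω 1 (upperBoundary Ω) := by
  refine ⟨Or.inl rfl, fun x hx => ?_, fun p hp => ?_⟩
  · exact (isCompact_section hcompact x).sSup_mem (exists_mem_of_mem_Icc hconvex hcompact hne hx)
  · rw [one_mul, one_mul]
    exact le_csSup (isCompact_section hcompact p.1).bddAbove hp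

theorem isBoundaryGraph_lowerBoundary (hconvex : Convex ℝ Ω) (hcompact : IsCompact Ω)
    (hne : Ω.Nonempty) : IsBoundaryGraph Ω (-1) (lowerBoundary Ω) := by
  refine ⟨Or.inr rfl, fun x hx => ?_, fun p hp => ?_⟩
  · exact (isCompact_section hcompact x).sInf_mem (exists_mem_of_mem_Icc hconvex hcompact hne hx)
  · rw [neg_one_mul, neg_one_mul, neg_le_neg_iff]
    exact csInf_le (isCompact_section hcompact p.1).bddBelow hp

end Sections

namespace IsBoundaryGraph

variable {Ω : Set (ℝ × ℝ)} {σ : ℝ} {φ : ℝ → ℝ}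

theorem abs_sign (hφ : IsBoundaryGraph Ω σ φ) : |σ| = 1 := by
  rcases hφ.sign with rfl | rfl <;> simp

theorem sign_mul_self (hφ : IsBoundaryGraph Ω σ φ) : σ * σ = 1 := by
  rcases hφ.sign with rfl | rfl <;> simp

theorem concaveOn (hφ : IsBoundaryGraph Ω σ φ) (hconvex : Convex ℝ Ω) :
    ConcaveOn ℝ (Icc (leftEnd Ω) (rightEnd Ω)) fun x => σ * φ x := by
  refine ⟨convex_Icc _ _, fun x hx y hy s t hs ht hst => ?_⟩
  have := hφ.extremal _ (hconvex (hφ.mem x hx) (hφ.mem y hy) hs ht hst)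
  simp only [Prod.snd_add, Prod.smul_snd, Prod.fst_add, Prod.smul_fst, smul_eq_mul] at this ⊢
  linarith

theorem lt_of_mem_interior (hφ : IsBoundaryGraph Ω σ φ) {p : ℝ × ℝ} (hp : p ∈ interior Ω) :
    σ * p.2 < σ * φ p.1 := by
  have hcont : Continuous fun r : ℝ => p + r • ((0, σ) : ℝ × ℝ) := by fun_prop
  have hev : ∀ᶠ r in 𝓝[>] (0 : ℝ), p + r • ((0, σ) : ℝ × ℝ) ∈ interior Ω :=
    nhdsWithin_le_nhds (hcont.continuousAt.preimage_mem_nhds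
      (by simpa using isOpen_interior.mem_nhds hp))
  obtain ⟨r, hr, hr0⟩ := (hev.and self_mem_nhdsWithin).exists
  replace hr0 : 0 < r := hr0
  have h1 := hφ.extremal _ (interior_subset hr)
  simp only [Prod.fst_add, Prod.snd_add, Prod.smul_fst, Prod.smul_snd, smul_eq_mul, mul_zero,
    add_zero] at h1
  have h2 : σ * (p.2 + r * σ) = σ * p.2 + r * (σ * σ) := by ring
  rw [h2, hφ.sign_mul_self] at h1
  linarith

theorem notMem_interior (hφ : IsBoundaryGraph Ω σ φ) (x : ℝ) : (x, φ x) ∉ interior Ω :=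
  fun h => lt_irrefl _ (hφ.lt_of_mem_interior h)

theorem eventually_lt (hφ : IsBoundaryGraph Ω σ φ) (hcompact : IsCompact Ω) {x η : ℝ}
    (hη : σ * φ x < η) :
    ∀ᶠ t in 𝓝 x, t ∈ Icc (leftEnd Ω) (rightEnd Ω) → σ * φ t < η := by
  have hK : IsCompact (Prod.fst '' (Ω ∩ {p | η ≤ σ * p.2})) :=
    (hcompact.inter_right (isClosed_le continuous_const (by fun_prop))).image continuous_fst
  have hx : x ∉ Prod.fst '' (Ω ∩ {p | η ≤ σ * p.2}) := by
    rintro ⟨p, ⟨hp, hle⟩, rfl⟩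
    have hle : η ≤ σ * p.2 := hle
    linarith [hφ.extremal p hp]
  filter_upwards [hK.isClosed.isOpen_compl.mem_nhds hx] with t ht htI
  by_contra hlt
  exact ht ⟨(t, φ t), ⟨hφ.mem t htI, not_lt.1 hlt⟩, rfl⟩

theorem abs_sub_eq (hφ : IsBoundaryGraph Ω σ φ) (y z : ℝ) : |σ * y - σ * z| = |y - z| := by
  rw [← mul_sub, abs_mul, hφ.abs_sign, one_mul]

theorem ofReal_slope_le_KInfty (hφ : IsBoundaryGraph Ω σ φ) (hconvex : Convex ℝ Ω)
    (hcompact : IsCompact Ω) (hint : (interior Ω).Nonempty) {x t : ℝ}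
    (hx : x ∈ Icc (leftEnd Ω) (rightEnd Ω)) (ht : t ∈ Icc (leftEnd Ω) (rightEnd Ω)) :
    ENNReal.ofReal (|φ t - φ x| / |t - x|) ≤ KInfty Ω := by
  wlog hlt : σ * φ x < σ * φ t generalizing x t
  · rcases (not_lt.1 hlt).eq_or_lt with h | h
    · rw [← hφ.abs_sub_eq, h]
      simp
    · rw [abs_sub_comm (φ t), abs_sub_comm t]
      exact this ht hx h
  have htx : 0 < |t - x| := by
    rw [abs_pos, sub_ne_zero]
    rintro rfl
    exact lt_irrefl _ hlt
  have hIoo : ∀ x' ∈ Ioo (leftEnd Ω) (rightEnd Ω), σ * φ x' < σ * φ t →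
      ENNReal.ofReal ((σ * φ t - σ * φ x') / |t - x'|) ≤ KInfty Ω := by
    intro x' hx' hlt'
    obtain ⟨y, hy⟩ := exists_mem_interior_of_mem_Ioo hconvex hcompact hint hx'
    have h1 := hφ.lt_of_mem_interior hy
    have h2 := ofReal_slope_le_KInfty_of_interior hconvex
      (hφ.mem x' (Ioo_subset_Icc_self hx')) (hφ.notMem_interior x') (hφ.mem t ht) hy rfl (by
        have h3 : σ * (y - φ x') * (σ * (φ t - φ x')) < 0 :=
          mul_neg_of_neg_of_pos (by linarith) (by linarith)
        have h4 : σ * (y - φ x') * (σ * (φ t - φ x')) =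
          σ * σ * ((y - φ x') * (φ t - φ x')) := by ring
        rwa [h4, hφ.sign_mul_self, one_mul] at h3)
    rwa [← hφ.abs_sub_eq, abs_of_pos (sub_pos.2 hlt')] at h2
  have hab : leftEnd Ω < rightEnd Ω := by
    obtain ⟨w, hw⟩ := hint
    exact (fst_mem_Ioo hcompact hw).1.trans (fst_mem_Ioo hcompact hw).2
  have hne : (𝓝[Ioo (leftEnd Ω) (rightEnd Ω)] x).NeBot := by
    rw [← mem_closure_iff_nhdsWithin_neBot, closure_Ioo hab.ne]
    exact hx
  have hη : ∀ η ∈ Ioo (σ * φ x) (σ * φ t),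
      ENNReal.ofReal ((σ * φ t - η) / |t - x|) ≤ KInfty Ω := by
    intro η hη
    have hlim : Tendsto (fun x' => (σ * φ t - η) / |t - x'|)
        (𝓝[Ioo (leftEnd Ω) (rightEnd Ω)] x) (𝓝 ((σ * φ t - η) / |t - x|)) := by
      refine tendsto_const_nhds.div ?_ htx.ne'
      have : Continuous fun x' => |t - x'| := by fun_prop
      exact (this.tendsto x).mono_left nhdsWithin_le_nhds
    refine le_of_tendsto (ENNReal.tendsto_ofReal hlim) ?_
    filter_upwards [nhdsWithin_le_nhds (hφ.eventually_lt hcompact hη.1), self_mem_nhdsWithin]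
      with x' h1 h2
    have h3 := h1 (Ioo_subset_Icc_self h2)
    refine le_trans (ENNReal.ofReal_le_ofReal ?_) (hIoo x' h2 (h3.trans hη.2))
    gcongr
  rw [← hφ.abs_sub_eq, abs_of_pos (sub_pos.2 hlt)]
  have hlim : Tendsto (fun η => (σ * φ t - η) / |t - x|) (𝓝[>] (σ * φ x))
      (𝓝 ((σ * φ t - σ * φ x) / |t - x|)) := by
    have : Continuous fun η => (σ * φ t - η) / |t - x| := by fun_prop
    exact (this.tendsto _).mono_left nhdsWithin_le_nhds
  refine le_of_tendsto (ENNReal.tendsto_ofReal hlim) ?_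
  filter_upwards [Ioo_mem_nhdsGT hlt] with η h using hη η h

theorem abs_slope_le (hφ : IsBoundaryGraph Ω σ φ) (hconvex : Convex ℝ Ω)
    {η C η' C' : ℝ} (hl : HasConeAt Ω (leftEnd Ω) η C) (hr : HasConeAt Ω (rightEnd Ω) η' C')
    {x t : ℝ} (hx : x ∈ Icc (leftEnd Ω) (rightEnd Ω)) (ht : t ∈ Icc (leftEnd Ω) (rightEnd Ω)) :
    |φ t - φ x| / |t - x| ≤ max |C| |C'| := by
  wlog hlt : x < t generalizing x t
  · rcases (not_lt.1 hlt).eq_or_lt with rfl | h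
    · simp
    · rw [abs_sub_comm (φ t), abs_sub_comm t]
      exact this ht hx h
  have hab := hx.1.trans hx.2
  have hcone : ∀ c η C, HasConeAt Ω c η C → c ∈ Icc (leftEnd Ω) (rightEnd Ω) →
      ∀ z ∈ Icc (leftEnd Ω) (rightEnd Ω), |σ * φ z - σ * φ c| ≤ |C| * |z - c| := by
    intro c η C h hc z hz
    have h1 := h.2 _ (hφ.mem c hc)
    simp only [sub_self, abs_zero, mul_zero] at h1
    have h2 : φ c = η := sub_eq_zero.1 (abs_nonpos_iff.1 h1)
    rw [hφ.abs_sub_eq, h2]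
    exact (h.2 _ (hφ.mem z hz)).trans
      (mul_le_mul_of_nonneg_right (le_abs_self C) (abs_nonneg _))
  have hconc := hφ.concaveOn hconvex
  have hup : (σ * φ t - σ * φ x) / (t - x) ≤ |C| := by
    have hL := left_mem_Icc.2 hab
    rcases hx.1.eq_or_lt with h | h
    · have h1 := hcone _ _ _ hl hL t ht
      rw [h, abs_of_pos (sub_pos.2 hlt)] at h1
      rw [div_le_iff₀ (sub_pos.2 hlt)]
      exact (le_abs_self _).trans h1
    · refine (hconc.slope_anti_adjacent hL ht h hlt).trans ?_
      rw [div_le_iff₀ (sub_pos.2 h), ← abs_of_pos (sub_pos.2 h)]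
      exact (le_abs_self _).trans (hcone _ _ _ hl hL x hx)
  have hdown : -|C'| ≤ (σ * φ t - σ * φ x) / (t - x) := by
    have hR := right_mem_Icc.2 hab
    rcases ht.2.eq_or_lt with h | h
    · have h1 := hcone _ _ _ hr hR x hx
      rw [← h, abs_sub_comm, abs_sub_comm x, abs_of_pos (sub_pos.2 hlt)] at h1
      rw [le_div_iff₀ (sub_pos.2 hlt)]
      linarith [neg_abs_le (σ * φ t - σ * φ x)]
    · refine le_trans ?_ (hconc.slope_anti_adjacent hx hR hlt h)
      have h1 := hcone _ _ _ hr hR t ht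
      rw [abs_sub_comm, abs_sub_comm t, abs_of_pos (sub_pos.2 h)] at h1
      rw [le_div_iff₀ (sub_pos.2 h)]
      linarith [neg_abs_le (σ * φ (rightEnd Ω) - σ * φ t)]
  rw [← hφ.abs_sub_eq, ← abs_div]
  exact abs_le.2 ⟨(neg_le_neg (le_max_right _ _)).trans hdown, hup.trans (le_max_left _ _)⟩

theorem exists_mem_oneSidedDerivatives (hφ : IsBoundaryGraph Ω σ φ) (hconvex : Convex ℝ Ω)
    {x t : ℝ} (hx : x ∈ Icc (leftEnd Ω) (rightEnd Ω)) (ht : t ∈ Icc (leftEnd Ω) (rightEnd Ω))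
    (hlt : σ * φ x < σ * φ t) :
    ∃ d ∈ oneSidedDerivatives φ (leftEnd Ω) (rightEnd Ω),
      ENNReal.ofReal (|φ t - φ x| / |t - x|) ≤ d.abs := by
  obtain ⟨d, hd, hle⟩ := (hφ.concaveOn hconvex).exists_mem_oneSidedDerivatives hx ht hlt
  rw [hφ.abs_sub_eq] at hle
  rcases hφ.sign with rfl | rfl
  · simp only [one_mul] at hd
    exact ⟨d, hd, hle⟩
  · have := neg_mem_oneSidedDerivatives hd
    simp only [neg_mul, one_mul, neg_neg] at this
    exact ⟨-d, this, by rwa [EReal.abs_neg]⟩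

end IsBoundaryGraph

section MaxSlope

variable {Ω : Set (ℝ × ℝ)}

theorem maxBoundarySlope_le_ofReal (hconvex : Convex ℝ Ω) (hcompact : IsCompact Ω)
    (hne : Ω.Nonempty) {k : ℝ}
    (hk : ∀ σ φ, IsBoundaryGraph Ω σ φ → ∀ x ∈ Icc (leftEnd Ω) (rightEnd Ω),
      ∀ t ∈ Icc (leftEnd Ω) (rightEnd Ω), |φ t - φ x| / |t - x| ≤ k) :
    maxBoundarySlope Ω ≤ ENNReal.ofReal k := by
  refine sSup_le ?_
  rintro _ ⟨d, hd | hd, rfl⟩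
  · exact abs_le_of_mem_oneSidedDerivatives
      (hk _ _ (isBoundaryGraph_lowerBoundary hconvex hcompact hne)) hd
  · exact abs_le_of_mem_oneSidedDerivatives
      (hk _ _ (isBoundaryGraph_upperBoundary hconvex hcompact hne)) hd

theorem maxBoundarySlope_le_KInfty (hconvex : Convex ℝ Ω) (hcompact : IsCompact Ω)
    (hint : (interior Ω).Nonempty) : maxBoundarySlope Ω ≤ KInfty Ω := by
  rcases eq_or_ne (KInfty Ω) ⊤ with h | h
  · rw [h]
    exact le_top
  rw [← ENNReal.ofReal_toReal h]
  refine maxBoundarySlope_le_ofReal hconvex hcompact (hint.mono interior_subset)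
    fun σ φ hφ x hx t ht => ?_
  have := hφ.ofReal_slope_le_KInfty hconvex hcompact hint hx ht
  rwa [← ENNReal.ofReal_toReal h, ENNReal.ofReal_le_ofReal_iff ENNReal.toReal_nonneg] at this

theorem HasConeAt.snd_eq {c η C : ℝ} (h : HasConeAt Ω c η C) {p : ℝ × ℝ} (hp : p ∈ Ω)
    (hpc : p.1 = c) : p.2 = η := by
  have h1 := h.2 p hp
  rw [hpc, sub_self, abs_zero, mul_zero] at h1
  exact sub_eq_zero.1 (abs_nonpos_iff.1 h1)

theorem snd_eq_boundary_of_mem_frontier (hconvex : Convex ℝ Ω) (hcompact : IsCompact Ω)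
    (hint : (interior Ω).Nonempty) {η C η' C' : ℝ} (hl : HasConeAt Ω (leftEnd Ω) η C)
    (hr : HasConeAt Ω (rightEnd Ω) η' C') {p : ℝ × ℝ} (hp : p ∈ frontier Ω) :
    p.2 = upperBoundary Ω p.1 ∨ p.2 = lowerBoundary Ω p.1 := by
  have hne : Ω.Nonempty := hint.mono interior_subset
  have hU := isBoundaryGraph_upperBoundary hconvex hcompact hne
  have hL := isBoundaryGraph_lowerBoundary hconvex hcompact hne
  have hpΩ : p ∈ Ω := hcompact.isClosed.frontier_subset hp
  have hpI := fst_mem_Icc hcompact hpΩ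
  have hend : p.1 = leftEnd Ω ∨ p.1 = rightEnd Ω → p.2 = upperBoundary Ω p.1 := by
    rintro (h | h)
    · exact (hl.snd_eq hpΩ h).trans (hl.snd_eq (hU.mem _ hpI) h).symm
    · exact (hr.snd_eq hpΩ h).trans (hr.snd_eq (hU.mem _ hpI) h).symm
  obtain ⟨f, hf⟩ := geometric_hahn_banach_open_point hconvex.interior isOpen_interior hp.2
  have hle : ∀ q ∈ Ω, f q ≤ f p := by
    have h1 : closure (interior Ω) ⊆ {q | f q ≤ f p} :=
      closure_minimal (fun q hq => (hf q hq).le) (isClosed_le f.continuous continuous_const)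
    intro q hq
    refine h1 ?_
    rw [hconvex.closure_interior_eq_closure_of_nonempty_interior hint]
    exact subset_closure hq
  have hfq : ∀ q : ℝ × ℝ, f q = f (1, 0) * q.1 + f (0, 1) * q.2 := by
    intro q
    have : q = q.1 • ((1, 0) : ℝ × ℝ) + q.2 • (0, 1) := by ext <;> simp
    conv_lhs => rw [this, map_add, map_smul, map_smul]
    simp only [smul_eq_mul]
    ring
  have hu := hle _ (hU.mem _ hpI)
  have hd := hle _ (hL.mem _ hpI)
  have hu' := hU.extremal p hpΩ
  have hd' := hL.extremal p hpΩ
  rw [hfq, hfq p] at hu hd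
  rcases lt_trichotomy (f (0, 1)) 0 with hβ | hβ | hβ
  · right
    refine le_antisymm ?_ (by linarith)
    by_contra hlt
    nlinarith [mul_pos (neg_pos.2 hβ) (sub_pos.2 (not_le.1 hlt))]
  · left
    have hf1 : ∀ q ∈ Ω, f (1, 0) * q.1 ≤ f (1, 0) * p.1 := by
      intro q hq
      have := hle q hq
      rw [hfq, hfq p, hβ] at this
      linarith
    obtain ⟨w, hw⟩ := hint
    have hα : f (1, 0) ≠ 0 := by
      intro h0
      have := hf w hw
      rw [hfq, hfq p, hβ, h0] at this
      linarith
    refine hend ?_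
    have hab := hpI.1.trans hpI.2
    rcases hα.lt_or_gt with h | h
    · left
      have := hf1 _ (hU.mem _ (left_mem_Icc.2 hab))
      exact le_antisymm ((mul_le_mul_left_of_neg h).1 this) hpI.1
    · right
      have := hf1 _ (hU.mem _ (right_mem_Icc.2 hab))
      exact le_antisymm hpI.2 (le_of_mul_le_mul_left this h)
  · left
    refine le_antisymm (by linarith) ?_
    by_contra hlt
    nlinarith [mul_pos hβ (sub_pos.2 (not_le.1 hlt))]

theorem KInfty_le_maxBoundarySlope (hconvex : Convex ℝ Ω) (hcompact : IsCompact Ω)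
    (hint : (interior Ω).Nonempty) {η C η' C' : ℝ} (hl : HasConeAt Ω (leftEnd Ω) η C)
    (hr : HasConeAt Ω (rightEnd Ω) η' C') (htop : maxBoundarySlope Ω ≠ ⊤) :
    KInfty Ω ≤ maxBoundarySlope Ω := by
  have hne : Ω.Nonempty := hint.mono interior_subset
  rw [← ENNReal.ofReal_toReal htop]
  refine KInfty_le_ofReal hcompact ENNReal.toReal_nonneg fun v hv τ hτ0 hτ => ?_
  have hmem := hcompact.isClosed.frontier_subset hτ
  have key : ∀ σ φ, IsBoundaryGraph Ω σ φ →
      (∀ d ∈ oneSidedDerivatives φ (leftEnd Ω) (rightEnd Ω), d.abs ≤ maxBoundarySlope Ω) →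
      (v + (τ, 0)).2 = φ (v + (τ, 0)).1 →
      ∃ δ : ℝ, v + (0, δ) ∈ frontier Ω ∧ |δ| ≤ (maxBoundarySlope Ω).toReal * |τ| := by
    intro σ φ hφ hder heq
    have hvI := fst_mem_Icc hcompact (interior_subset hv)
    have hlt := hφ.lt_of_mem_interior hv
    simp only [Prod.snd_add, Prod.fst_add, add_zero] at heq
    obtain ⟨d, hd, hle⟩ := hφ.exists_mem_oneSidedDerivatives hconvex
      (fst_mem_Icc hcompact hmem) hvI (by simpa only [Prod.fst_add, ← heq] using hlt)
    have h1 := hle.trans (hder d hd)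
    simp only [Prod.fst_add, ← heq, sub_add_cancel_left, abs_neg] at h1
    rw [← ENNReal.ofReal_toReal htop, ENNReal.ofReal_le_ofReal_iff ENNReal.toReal_nonneg,
      div_le_iff₀ (abs_pos.2 hτ0)] at h1
    have e : v + (0, φ v.1 - v.2) = (v.1, φ v.1) := by ext <;> simp
    refine ⟨φ v.1 - v.2, ?_, h1⟩
    rw [e]
    exact ⟨subset_closure (hφ.mem _ hvI), hφ.notMem_interior _⟩
  rcases snd_eq_boundary_of_mem_frontier hconvex hcompact hint hl hr hτ with h | h
  · exact key _ _ (isBoundaryGraph_upperBoundary hconvex hcompact hne)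
      (fun d hd => le_sSup ⟨d, Or.inr hd, rfl⟩) h
  · exact key _ _ (isBoundaryGraph_lowerBoundary hconvex hcompact hne)
      (fun d hd => le_sSup ⟨d, Or.inl hd, rfl⟩) h

end MaxSlope

theorem theorem8 (Ω : Set (ℝ × ℝ)) (hconvex : Convex ℝ Ω) (hcompact : IsCompact Ω)
    (hint : (interior Ω).Nonempty) :
    (VerticalSupportLinesAngular Ω → KInfty Ω = maxBoundarySlope Ω ∧ maxBoundarySlope Ω < ⊤) ∧
    (¬ VerticalSupportLinesAngular Ω → KInfty Ω = ⊤) := by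
  have hne : Ω.Nonempty := hint.mono interior_subset
  refine ⟨fun hang => ?_, fun hnot => ?_⟩
  · obtain ⟨η, C, hl⟩ := (hang _ (isSupportLine_verticalLine_leftEnd hcompact
      hne)).exists_hasConeAt hcompact
    obtain ⟨η', C', hr⟩ := (hang _ (isSupportLine_verticalLine_rightEnd hcompact
      hne)).exists_hasConeAt hcompact
    have hlt : maxBoundarySlope Ω < ⊤ :=
      (maxBoundarySlope_le_ofReal hconvex hcompact hne fun σ φ hφ x hx t ht =>
        hφ.abs_slope_le hconvex hl hr hx ht).trans_lt ENNReal.ofReal_lt_top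
    exact ⟨le_antisymm (KInfty_le_maxBoundarySlope hconvex hcompact hint hl hr hlt.ne)
      (maxBoundarySlope_le_KInfty hconvex hcompact hint), hlt⟩
  · simp only [VerticalSupportLinesAngular, not_forall] at hnot
    obtain ⟨c, hline, hang⟩ := hnot
    exact KInfty_eq_top_of_forall_not_hasConeAt hconvex hint hline
      fun η C h => hang (h.isAngularSupportLine hline)
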